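/- Let $\Bbbk$ be a field. For a module $X$ over a $\Bbbk$-algebra $R$ let $\mathrm{GK}(X)=\sup_{V,F}\limsup_n \log_n\dim_\Bbbk(V^nF)$ be its Gelfand–Kirillov dimension ($V\ni 1$ and $F$ run over the finite-dimensional subspaces of $R$ and $X$; $\mathrm{GK}(0)=-\infty$), and let $j_R(X)=\inf\{i:\mathrm{Ext}^i_R(X,R)\ne0\}$. A (two-sided) noetherian algebra $R$ is *Auslander regular* if it has finite global dimension and, for every finitely generated left or right $R$-module $X$, every $q\ge 0$ and every submodule $Y\subseteq\mathrm{Ext}^q_R(X,R)$ on the other side, $j_R(Y)\ge q$; it is *CM* if $\mathrm{GK}(R)\in\mathbb N$ and $j_R(X)+\mathrm{GK}(X)=\mathrm{GK}(R)$ for every nonzero finitely generated left or right $R$-module $X$. Bimodules are $\Bbbk$-central. Two $(D,R)$-bimodules $X,Y$ are *$s$-isomorphic*, $X\cong_s Y$, if there are a $(D,R)$-bimodule $P$ and bimodule maps $X\to P$, $Y\to P$ whose kernels and cokernels have $\mathrm{GK}\le s$ as right $R$-modules; *as graded bimodules* means that $P$ is $\mathbb Z$-graded and the maps preserve degrees.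 Let $A$ be a noetherian algebra with $\mathrm{GK}(A)=d\in\mathbb N$, $d\ge2$. A *noncommutative quasi-resolution* (NQR) of $A$ is a triple $(B,M,N)$ of a noetherian Auslander regular CM algebra $B$ with $\mathrm{GK}(B)=d$, a $(B,A)$-bimodule $M$ and an $(A,B)$-bimodule $N$, both finitely generated on both sides, such that $M\otimes_AN\cong_{d-2}B$ and $N\otimes_BM\cong_{d-2}A$ as bimodules. It is a *graded NQR* of $A$ if moreover $A$ and $B$ are locally finite $\mathbb N$-graded algebras (every homogeneous component is finite-dimensional), $M$ and $N$ are $\mathbb Z$-graded bimodules, and both $(d-2)$-isomorphisms are as graded bimodules. **Proposition 8.3.** Let $B$ be a noetherian locally finite $\mathbb N$-graded $\Bbbk$-algebra which is Auslander regular and CM with $\mathrm{GK}(B)=d\ge 2$. Let $e\in B$ be an idempotent and $A=eBe$. Suppose that the $(B,A)$-bimodule $Be$ and the $(A,B)$-bimodule $eB$ are finitely generated on both sides and that $\mathrm{GK}(B/BeB)\le d-2$. Then $(B,Be,eB)$ is an NQR of $A$. If moreover $e\in B_0$, then $(B,Be,eB)$ is a graded NQR of $A$, where $A$, $Be$ and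 $eB$ carry the gradings induced from $B$. -/

import Mathlib

open scoped TensorProduct ENNReal
open MulOpposite

namespace QuasiRes

universe u v

/-! ### Conventions

`k` is the base field.  Left `R`-modules are `Module R M`; right `R`-modules are `Module Rᵐᵒᵖ M`.
A `(D, A)`-bimodule is a left `D`-module which is a right `A`-module, the two actions commuting and
inducing the same action of `k`. -/

/-! ### Gelfand-Kirillov dimension -/

section GK

variable (k : Type u) [Field k] (R : Type v) [Ring R] [Algebra k R]

/-- The Gelfand-Kirillov dimension of an `R`-module `M`:
the supremum of `limsup_n log_n dim_k (V ^ n F)` over the finite-dimensional subspaces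
`V ∋ 1` of `R` and `F` of `M`.  It is `⊥ = -∞` exactly for the zero module.
For a right `R`-module, take `Rᵐᵒᵖ` as the ring.
The dimension of an algebra is that of the algebra as a module over itself. -/
noncomputable def gkDim (M : Type*) [AddCommGroup M] [Module k M] [Module R M]
    [IsScalarTower k R M] : EReal :=
  ⨆ (V : Submodule k R) (F : Submodule k M) (_ : (1 : R) ∈ V) (_ : V.FG) (_ : F.FG),
    Filter.limsup
      (fun n : ℕ =>
        ENNReal.log ((Module.finrank k ↥(V ^ n • F) : ℕ) : ℝ≥0∞) / ((Real.log n : ℝ) : EReal))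
      Filter.atTop

end GK

/-! ### Homological conditions -/

section Homological

open CategoryTheory CategoryTheory.Abelian

variable (R : Type v) [Ring R]

/-- Right multiplication by an element of `R`, as an endomorphism of the left `R`-module `R`. -/
def rightMul (r : Rᵐᵒᵖ) : R →ₗ[R] R where
  toFun x := x * unop r
  map_add' x y := add_mul x y _
  map_smul' a x := mul_assoc a x _

/-- `Ext^q_R(M, R)` for a left `R`-module `M`. -/
abbrev ExtRing (M : Type v) [AddCommGroup M] [Module R M] (q : ℕ) : Type v :=
  Ext (ModuleCat.of R M) (ModuleCat.of R R) q

/-- The additive endomorphism of `Ext^q_R(M, R)` induced by right multiplication by `r` on `R`. -/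
noncomputable def extRightMul (M : Type v) [AddCommGroup M] [Module R M] (q : ℕ) :
    Rᵐᵒᵖ →+* AddMonoid.End (ExtRing R M q) where
  toFun r :=
    { toFun := fun α => α.comp (Ext.mk₀ (ModuleCat.ofHom (rightMul R r))) (add_zero q)
      map_zero' := Ext.zero_comp _ _ _ _ (add_zero q)
      map_add' := fun α β => Ext.add_comp α β _ _ }
  map_one' := by
    refine AddMonoidHom.ext fun α => ?_
    have h : ModuleCat.ofHom (rightMul R 1) = 𝟙 (ModuleCat.of R R) := by
      apply ModuleCat.hom_ext
      refine LinearMap.ext fun (x : R) => ?_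
      change x * 1 = x
      exact mul_one x
    change α.comp (Ext.mk₀ (ModuleCat.ofHom (rightMul R 1))) (add_zero q) = α
    rw [h, Ext.comp_mk₀_id]
  map_zero' := by
    refine AddMonoidHom.ext fun α => ?_
    have h : ModuleCat.ofHom (rightMul R 0) = (0 : ModuleCat.of R R ⟶ ModuleCat.of R R) := by
      apply ModuleCat.hom_ext
      refine LinearMap.ext fun (x : R) => ?_
      change x * 0 = 0
      exact mul_zero x
    change α.comp (Ext.mk₀ (ModuleCat.ofHom (rightMul R 0))) (add_zero q) = 0
    rw [h, Ext.mk₀_zero, Ext.comp_zero]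
  map_add' r s := by
    refine AddMonoidHom.ext fun α => ?_
    have h : ModuleCat.ofHom (rightMul R (r + s)) =
        ModuleCat.ofHom (rightMul R r) + ModuleCat.ofHom (rightMul R s) := by
      apply ModuleCat.hom_ext
      refine LinearMap.ext fun (x : R) => ?_
      change x * (unop r + unop s) = x * unop r + x * unop s
      exact mul_add _ _ _
    change α.comp (Ext.mk₀ (ModuleCat.ofHom (rightMul R (r + s)))) (add_zero q) =
      α.comp (Ext.mk₀ (ModuleCat.ofHom (rightMul R r))) (add_zero q) +
      α.comp (Ext.mk₀ (ModuleCat.ofHom (rightMul R s))) (add_zero q)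
    rw [h, Ext.mk₀_add, Ext.comp_add]
  map_mul' r s := by
    refine AddMonoidHom.ext fun α => ?_
    have h : ModuleCat.ofHom (rightMul R (r * s)) =
        ModuleCat.ofHom (rightMul R s) ≫ ModuleCat.ofHom (rightMul R r) := by
      apply ModuleCat.hom_ext
      refine LinearMap.ext fun (x : R) => ?_
      change x * (unop s * unop r) = x * unop s * unop r
      exact (mul_assoc _ _ _).symm
    change α.comp (Ext.mk₀ (ModuleCat.ofHom (rightMul R (r * s)))) (add_zero q) =
      (α.comp (Ext.mk₀ (ModuleCat.ofHom (rightMul R s))) (add_zero q)).comp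
        (Ext.mk₀ (ModuleCat.ofHom (rightMul R r))) (add_zero q)
    rw [h, ← Ext.mk₀_comp_mk₀, Ext.comp_assoc_of_third_deg_zero]

/-- The right `R`-module structure of `Ext^q_R(M, R)`. -/
noncomputable instance extRingModule (M : Type v) [AddCommGroup M] [Module R M] (q : ℕ) :
    Module Rᵐᵒᵖ (ExtRing R M q) :=
  Module.compHom _ (extRightMul R M q)

/-- The grade number `j_R(M) = inf {i | Ext^i_R(M, R) ≠ 0}` of a left `R`-module,
with `inf ∅ = +∞`. -/
noncomputable def gradeNumber (M : Type v) [AddCommGroup M] [Module R M] : ℕ∞ :=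
  ⨅ (i : ℕ) (_ : Nontrivial (ExtRing R M i)), (i : ℕ∞)

/-- Every finitely generated left `R`-module satisfies the Auslander condition:
`j(N) ≥ q` for every `q` and every right `R`-submodule `N` of `Ext^q_R(M, R)`. -/
def LeftAuslander : Prop :=
  ∀ (M : Type v) [AddCommGroup M] [Module R M] [Module.Finite R M] (q : ℕ)
    (N : Submodule Rᵐᵒᵖ (ExtRing R M q)), (q : ℕ∞) ≤ gradeNumber Rᵐᵒᵖ ↥N

/-- Every left `R`-module has projective dimension at most `n`. -/
def LeftGlobalDimLE (n : ℕ) : Prop :=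
  ∀ M : ModuleCat.{v} R, HasProjectiveDimensionLE M n

/-- Auslander regular rings: finite global dimension, and all finitely generated left and right
modules satisfy the Auslander condition.  A right `R`-module is a left `Rᵐᵒᵖ`-module; left and
right modules over `Rᵐᵒᵖᵐᵒᵖ` are left and right modules over `R`. -/
structure IsAuslanderRegular : Prop where
  left_gldim : ∃ n, LeftGlobalDimLE R n
  right_gldim : ∃ n, LeftGlobalDimLE Rᵐᵒᵖ n
  left_auslander : LeftAuslander R
  right_auslander : LeftAuslander Rᵐᵒᵖ

variable (k : Type u) [Field k] [Algebra k R]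

/-- `j(M) + GK(M) = d` for every nonzero finitely generated left `R`-module `M`. -/
def LeftCM (d : ℕ) : Prop :=
  ∀ (M : Type v) [AddCommGroup M] [Module k M] [Module R M] [IsScalarTower k R M]
    [Module.Finite R M] [Nontrivial M],
    ((gradeNumber R M : ℝ≥0∞) : EReal) + gkDim k R M = (d : EReal)

/-- `R` is (`GK`-)Cohen-Macaulay with `GK(R) = d`. -/
structure IsCohenMacaulay (d : ℕ) : Prop where
  gkDim_eq : gkDim k Rᵐᵒᵖ R = (d : EReal)
  left_cm : LeftCM R k d
  right_cm : LeftCM Rᵐᵒᵖ k d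

end Homological

/-! ### Tensor products of bimodules over a noncommutative ring -/

section BalTensor

variable (k : Type u) [Field k] (A : Type*) [Ring A] [Algebra k A]
  (M : Type*) [AddCommGroup M] [Module k M] [Module Aᵐᵒᵖ M] [IsScalarTower k Aᵐᵒᵖ M]
  (N : Type*) [AddCommGroup N] [Module k N] [Module A N] [IsScalarTower k A N]

/-- The subspace of `M ⊗[k] N` spanned by all `m a ⊗ n - m ⊗ a n`. -/
def balancedRel : Submodule k (M ⊗[k] N) :=
  Submodule.span k {t | ∃ (m : M) (a : A) (n : N), t = (op a • m) ⊗ₜ[k] n - m ⊗ₜ[k] (a • n)}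

/-- The tensor product `M ⊗_A N` of a right and a left module over the `k`-algebra `A`. -/
def BalTensor : Type _ := (M ⊗[k] N) ⧸ balancedRel k A M N

namespace BalTensor

instance instAddCommGroup : AddCommGroup (BalTensor k A M N) :=
  inferInstanceAs (AddCommGroup ((M ⊗[k] N) ⧸ balancedRel k A M N))

instance instModuleBase : Module k (BalTensor k A M N) :=
  inferInstanceAs (Module k ((M ⊗[k] N) ⧸ balancedRel k A M N))

/-- The canonical map from the tensor product over `k`. -/
def mk : (M ⊗[k] N) →ₗ[k] BalTensor k A M N := (balancedRel k A M N).mkQ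

variable {M N} in
/-- The pure tensor `m ⊗ n` in `M ⊗_A N`. -/
def tmul (m : M) (n : N) : BalTensor k A M N := mk k A M N (m ⊗ₜ[k] n)

theorem mk_surjective : Function.Surjective (mk k A M N) := Submodule.mkQ_surjective _

/-- Endomorphisms of `M ⊗[k] N` preserving the relations descend. -/
def descend (f : Module.End k (M ⊗[k] N))
    (hf : balancedRel k A M N ≤ (balancedRel k A M N).comap f) :
    Module.End k (BalTensor k A M N) :=
  Submodule.mapQ (balancedRel k A M N) (balancedRel k A M N) f hf

variable {k A M N} in
@[simp]
theorem descend_mk (f : Module.End k (M ⊗[k] N))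
    (hf : balancedRel k A M N ≤ (balancedRel k A M N).comap f) (t : M ⊗[k] N) :
    descend k A M N f hf (mk k A M N t) = mk k A M N (f t) := rfl

variable {k A M N} in
theorem end_ext {f g : Module.End k (BalTensor k A M N)}
    (h : ∀ t, f (mk k A M N t) = g (mk k A M N t)) : f = g := by
  refine LinearMap.ext fun x => ?_
  obtain ⟨t, rfl⟩ := mk_surjective k A M N x
  exact h t

section Left

variable (D : Type*) [Ring D] [Algebra k D] [Module D M] [IsScalarTower k D M]
  [SMulCommClass D Aᵐᵒᵖ M]

/-- The left action of `D` on `M ⊗_A N` through `M`. -/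
def leftAction : D →+* Module.End k (BalTensor k A M N) where
  toFun b := descend k A M N (LinearMap.rTensor N (Algebra.lsmul k k M b)) <| by
    refine Submodule.span_le.2 ?_
    rintro _ ⟨m, a, n, rfl⟩
    refine Submodule.subset_span ⟨b • m, a, n, ?_⟩
    simp [smul_comm b (op a) m]
  map_one' := end_ext fun t => by
    change mk k A M N (LinearMap.rTensor N (Algebra.lsmul k k M 1) t) = mk k A M N t
    rw [map_one, Module.End.one_eq_id, LinearMap.rTensor_id, LinearMap.id_apply]
  map_zero' := end_ext fun t => by
    change mk k A M N (LinearMap.rTensor N (Algebra.lsmul k k M 0) t) = 0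
    rw [map_zero, LinearMap.rTensor_zero, LinearMap.zero_apply, map_zero]
  map_add' b c := end_ext fun t => by
    change mk k A M N (LinearMap.rTensor N (Algebra.lsmul k k M (b + c)) t) =
      mk k A M N (LinearMap.rTensor N (Algebra.lsmul k k M b) t) +
      mk k A M N (LinearMap.rTensor N (Algebra.lsmul k k M c) t)
    rw [map_add, LinearMap.rTensor_add, LinearMap.add_apply, map_add]
  map_mul' b c := end_ext fun t => by
    change mk k A M N (LinearMap.rTensor N (Algebra.lsmul k k M (b * c)) t) =
      mk k A M N (LinearMap.rTensor N (Algebra.lsmul k k M b)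
        (LinearMap.rTensor N (Algebra.lsmul k k M c) t))
    rw [map_mul, LinearMap.rTensor_mul, Module.End.mul_apply]

instance instModuleLeft : Module D (BalTensor k A M N) :=
  Module.compHom _ (leftAction k A M N D)

theorem smul_mk_left (b : D) (t : M ⊗[k] N) :
    b • mk k A M N t = mk k A M N (LinearMap.rTensor N (Algebra.lsmul k k M b) t) := rfl

theorem smul_tmul_left (b : D) (m : M) (n : N) :
    b • tmul k A m n = tmul k A (b • m) n := rfl

instance instIsScalarTowerLeft :
    @IsScalarTower k D (BalTensor k A M N) _ _ (instModuleBase k A M N).toSMul where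
  smul_assoc c b x := by
    obtain ⟨t, rfl⟩ := mk_surjective k A M N x
    change mk k A M N (LinearMap.rTensor N (Algebra.lsmul k k M (c • b)) t) =
      c • mk k A M N (LinearMap.rTensor N (Algebra.lsmul k k M b) t)
    rw [map_smul, LinearMap.rTensor_smul, LinearMap.smul_apply, map_smul]

end Left

section Right

variable (D : Type*) [Ring D] [Algebra k D] [Module Dᵐᵒᵖ N] [IsScalarTower k Dᵐᵒᵖ N]
  [SMulCommClass A Dᵐᵒᵖ N]

/-- The right action of `D` on `M ⊗_A N` through `N`. -/
def rightAction : Dᵐᵒᵖ →+* Module.End k (BalTensor k A M N) where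
  toFun b := descend k A M N (LinearMap.lTensor M (Algebra.lsmul k k N b)) <| by
    refine Submodule.span_le.2 ?_
    rintro _ ⟨m, a, n, rfl⟩
    refine Submodule.subset_span ⟨m, a, b • n, ?_⟩
    simp [smul_comm a b n]
  map_one' := end_ext fun t => by
    change mk k A M N (LinearMap.lTensor M (Algebra.lsmul k k N 1) t) = mk k A M N t
    rw [map_one, Module.End.one_eq_id, LinearMap.lTensor_id, LinearMap.id_apply]
  map_zero' := end_ext fun t => by
    change mk k A M N (LinearMap.lTensor M (Algebra.lsmul k k N 0) t) = 0
    rw [map_zero, LinearMap.lTensor_zero, LinearMap.zero_apply, map_zero]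
  map_add' b c := end_ext fun t => by
    change mk k A M N (LinearMap.lTensor M (Algebra.lsmul k k N (b + c)) t) =
      mk k A M N (LinearMap.lTensor M (Algebra.lsmul k k N b) t) +
      mk k A M N (LinearMap.lTensor M (Algebra.lsmul k k N c) t)
    rw [map_add, LinearMap.lTensor_add, LinearMap.add_apply, map_add]
  map_mul' b c := end_ext fun t => by
    change mk k A M N (LinearMap.lTensor M (Algebra.lsmul k k N (b * c)) t) =
      mk k A M N (LinearMap.lTensor M (Algebra.lsmul k k N b)
        (LinearMap.lTensor M (Algebra.lsmul k k N c) t))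
    rw [map_mul, LinearMap.lTensor_mul, Module.End.mul_apply]

instance instModuleRight : Module Dᵐᵒᵖ (BalTensor k A M N) :=
  Module.compHom _ (rightAction k A M N D)

theorem smul_mk_right (b : Dᵐᵒᵖ) (t : M ⊗[k] N) :
    b • mk k A M N t = mk k A M N (LinearMap.lTensor M (Algebra.lsmul k k N b) t) := rfl

theorem smul_tmul_right (b : Dᵐᵒᵖ) (m : M) (n : N) :
    b • tmul k A m n = tmul k A m (b • n) := rfl

instance instIsScalarTowerRight :
    @IsScalarTower k Dᵐᵒᵖ (BalTensor k A M N) _ _ (instModuleBase k A M N).toSMul where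
  smul_assoc c b x := by
    obtain ⟨t, rfl⟩ := mk_surjective k A M N x
    change mk k A M N (LinearMap.lTensor M (Algebra.lsmul k k N (c • b)) t) =
      c • mk k A M N (LinearMap.lTensor M (Algebra.lsmul k k N b) t)
    rw [map_smul, LinearMap.lTensor_smul, LinearMap.smul_apply, map_smul]

end Right

section Both

variable (D : Type*) [Ring D] [Algebra k D] [Module D M] [IsScalarTower k D M]
  [SMulCommClass D Aᵐᵒᵖ M]
  (E : Type*) [Ring E] [Algebra k E] [Module Eᵐᵒᵖ N] [IsScalarTower k Eᵐᵒᵖ N]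
  [SMulCommClass A Eᵐᵒᵖ N]

instance instSMulCommClass :
    @SMulCommClass D Eᵐᵒᵖ (BalTensor k A M N) (instModuleLeft k A M N D).toSMul
      (instModuleRight k A M N E).toSMul where
  smul_comm b c x := by
    obtain ⟨t, rfl⟩ := mk_surjective k A M N x
    change mk k A M N (LinearMap.rTensor N (Algebra.lsmul k k M b)
        (LinearMap.lTensor M (Algebra.lsmul k k N c) t)) =
      mk k A M N (LinearMap.lTensor M (Algebra.lsmul k k N c)
        (LinearMap.rTensor N (Algebra.lsmul k k M b) t))
    congr 1
    rw [← LinearMap.comp_apply, ← LinearMap.comp_apply, LinearMap.rTensor_comp_lTensor,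
      LinearMap.lTensor_comp_rTensor]

end Both

/-- The base field acts through the quotient (declared last, so that it is found first). -/
instance instModuleBase' : Module k (BalTensor k A M N) := instModuleBase k A M N

end BalTensor

end BalTensor

/-! ### Gradings -/

section Gradings

variable (k : Type u) [Field k]

/-- A locally finite `ℕ`-grading of the `k`-algebra `A`. -/
structure IsLocallyFiniteGrading {A : Type*} [Ring A] [Algebra k A]
    (𝒜 : ℕ → Submodule k A) : Prop where
  one_mem : (1 : A) ∈ 𝒜 0
  mul_mem : ∀ ⦃i j : ℕ⦄ ⦃a b : A⦄, a ∈ 𝒜 i → b ∈ 𝒜 j → a * b ∈ 𝒜 (i + j)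
  isInternal : DirectSum.IsInternal 𝒜
  finite : ∀ i, FiniteDimensional k ↥(𝒜 i)

variable {k}

/-- A `ℤ`-graded `(D, A)`-bimodule over `ℕ`-graded algebras `D` and `A`. -/
structure IsGradedBimodule {D A X : Type*} [Ring D] [Algebra k D] [Ring A] [Algebra k A]
    [AddCommGroup X] [Module k X] [Module D X] [Module Aᵐᵒᵖ X]
    (𝒟 : ℕ → Submodule k D) (𝒜 : ℕ → Submodule k A) (𝒳 : ℤ → Submodule k X) : Prop where
  isInternal : DirectSum.IsInternal 𝒳
  left_smul_mem : ∀ ⦃i : ℕ⦄ ⦃j : ℤ⦄ ⦃a : D⦄ ⦃x : X⦄,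
    a ∈ 𝒟 i → x ∈ 𝒳 j → a • x ∈ 𝒳 ((i : ℤ) + j)
  right_smul_mem : ∀ ⦃i : ℕ⦄ ⦃j : ℤ⦄ ⦃a : A⦄ ⦃x : X⦄,
    a ∈ 𝒜 i → x ∈ 𝒳 j → op a • x ∈ 𝒳 (j + (i : ℤ))

/-- An `ℕ`-indexed family viewed as a `ℤ`-indexed one, zero in negative degrees. -/
def intGrading {X : Type*} [AddCommGroup X] [Module k X] (𝒳 : ℕ → Submodule k X) :
    ℤ → Submodule k X
  | Int.ofNat n => 𝒳 n
  | Int.negSucc _ => ⊥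

/-- The grading of `M ⊗_A N` induced by gradings of `M` and `N`. -/
def tensorGrading {A M N : Type*} [Ring A] [Algebra k A]
    [AddCommGroup M] [Module k M] [Module Aᵐᵒᵖ M] [IsScalarTower k Aᵐᵒᵖ M]
    [AddCommGroup N] [Module k N] [Module A N] [IsScalarTower k A N]
    (ℳ : ℤ → Submodule k M) (𝒩 : ℤ → Submodule k N) :
    ℤ → Submodule k (BalTensor k A M N) := fun i =>
  Submodule.span k {t | ∃ p q : ℤ, p + q = i ∧ ∃ m ∈ ℳ p, ∃ n ∈ 𝒩 q, t = BalTensor.tmul k A m n}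

end Gradings

/-! ### Isomorphism up to modules of small dimension -/

section SIsomorphic

variable (k : Type u) [Field k]

/-- A map of right `A`-modules whose kernel and cokernel have `GK`-dimension at most `s`. -/
def IsSIso (A : Type*) [Ring A] [Algebra k A] (s : EReal) {X P : Type*}
    [AddCommGroup X] [Module k X] [Module Aᵐᵒᵖ X] [IsScalarTower k Aᵐᵒᵖ X]
    [AddCommGroup P] [Module k P] [Module Aᵐᵒᵖ P] [IsScalarTower k Aᵐᵒᵖ P]
    (f : X →ₗ[Aᵐᵒᵖ] P) : Prop :=
  gkDim k Aᵐᵒᵖ ↥(LinearMap.ker f) ≤ s ∧ gkDim k Aᵐᵒᵖ (P ⧸ LinearMap.range f) ≤ s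

/-- The `(D, A)`-bimodules `X` and `Y` are `s`-isomorphic. -/
def SIsomorphic (D A : Type*) [Ring D] [Algebra k D] [Ring A] [Algebra k A] (s : EReal)
    (X Y : Type v)
    [AddCommGroup X] [Module k X] [Module D X] [Module Aᵐᵒᵖ X]
    [IsScalarTower k D X] [IsScalarTower k Aᵐᵒᵖ X] [SMulCommClass D Aᵐᵒᵖ X]
    [AddCommGroup Y] [Module k Y] [Module D Y] [Module Aᵐᵒᵖ Y]
    [IsScalarTower k D Y] [IsScalarTower k Aᵐᵒᵖ Y] [SMulCommClass D Aᵐᵒᵖ Y] : Prop :=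
  ∃ (P : Type v) (_ : AddCommGroup P) (_ : Module k P) (_ : Module D P) (_ : Module Aᵐᵒᵖ P)
    (_ : IsScalarTower k D P) (_ : IsScalarTower k Aᵐᵒᵖ P) (_ : SMulCommClass D Aᵐᵒᵖ P)
    (f : X →ₗ[Aᵐᵒᵖ] P) (g : Y →ₗ[Aᵐᵒᵖ] P),
    (∀ (b : D) (x : X), f (b • x) = b • f x) ∧ (∀ (b : D) (y : Y), g (b • y) = b • g y) ∧
    IsSIso k A s f ∧ IsSIso k A s g

/-- The graded `(D, A)`-bimodules `X` and `Y` are `s`-isomorphic as graded bimodules: the third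
bimodule is graded and the maps preserve degrees. -/
def GradedSIsomorphic {k : Type u} [Field k]
    {D A : Type*} [Ring D] [Algebra k D] [Ring A] [Algebra k A]
    (𝒟 : ℕ → Submodule k D) (𝒜 : ℕ → Submodule k A) (s : EReal) {X Y : Type v}
    [AddCommGroup X] [Module k X] [Module D X] [Module Aᵐᵒᵖ X]
    [IsScalarTower k D X] [IsScalarTower k Aᵐᵒᵖ X] [SMulCommClass D Aᵐᵒᵖ X]
    [AddCommGroup Y] [Module k Y] [Module D Y] [Module Aᵐᵒᵖ Y]
    [IsScalarTower k D Y] [IsScalarTower k Aᵐᵒᵖ Y] [SMulCommClass D Aᵐᵒᵖ Y]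
    (𝒳 : ℤ → Submodule k X) (𝒴 : ℤ → Submodule k Y) : Prop :=
  ∃ (P : Type v) (_ : AddCommGroup P) (_ : Module k P) (_ : Module D P) (_ : Module Aᵐᵒᵖ P)
    (_ : IsScalarTower k D P) (_ : IsScalarTower k Aᵐᵒᵖ P) (_ : SMulCommClass D Aᵐᵒᵖ P)
    (𝒬 : ℤ → Submodule k P) (f : X →ₗ[Aᵐᵒᵖ] P) (g : Y →ₗ[Aᵐᵒᵖ] P),
    IsGradedBimodule 𝒟 𝒜 𝒬 ∧
    (∀ (b : D) (x : X), f (b • x) = b • f x) ∧ (∀ (b : D) (y : Y), g (b • y) = b • g y) ∧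
    (∀ i, ∀ x ∈ 𝒳 i, f x ∈ 𝒬 i) ∧ (∀ i, ∀ y ∈ 𝒴 i, g y ∈ 𝒬 i) ∧
    IsSIso k A s f ∧ IsSIso k A s g

end SIsomorphic

/-! ### Noncommutative quasi-resolutions -/

section QuasiResolution

variable (k : Type u) [Field k] (B A M N : Type v)
  [Ring B] [Algebra k B] [Ring A] [Algebra k A]
  [AddCommGroup M] [Module k M] [Module B M] [Module Aᵐᵒᵖ M]
  [IsScalarTower k B M] [IsScalarTower k Aᵐᵒᵖ M] [SMulCommClass B Aᵐᵒᵖ M]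
  [AddCommGroup N] [Module k N] [Module A N] [Module Bᵐᵒᵖ N]
  [IsScalarTower k A N] [IsScalarTower k Bᵐᵒᵖ N] [SMulCommClass A Bᵐᵒᵖ N]

/-- The conditions on the algebras and on the bimodules `M` and `N`, other than the two
isomorphisms, in the definition of a quasi-resolution in dimension `d`. -/
structure QuasiResolutionData (d : ℕ) : Prop where
  two_le : 2 ≤ d
  left_noetherian_base : IsNoetherianRing A
  right_noetherian_base : IsNoetherianRing Aᵐᵒᵖ
  gkDim_base : gkDim k Aᵐᵒᵖ A = (d : EReal)
  left_noetherian : IsNoetherianRing B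
  right_noetherian : IsNoetherianRing Bᵐᵒᵖ
  auslanderRegular : IsAuslanderRegular B
  cohenMacaulay : IsCohenMacaulay B k d
  finite_left_M : Module.Finite B M
  finite_right_M : Module.Finite Aᵐᵒᵖ M
  finite_left_N : Module.Finite A N
  finite_right_N : Module.Finite Bᵐᵒᵖ N

/-- `(B, M, N)` is a noncommutative quasi-resolution of the (ungraded) algebra `A` with
`GK(A) = d`. -/
structure IsNQR (d : ℕ) : Prop extends QuasiResolutionData k B A M N d where
  isoB : SIsomorphic k B B (((d : ℝ) - 2 : ℝ) : EReal) (BalTensor k A M N) B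
  isoA : SIsomorphic k A A (((d : ℝ) - 2 : ℝ) : EReal) (BalTensor k B N M) A

variable {k B A M N}

/-- `(B, M, N)` is a noncommutative quasi-resolution of the locally finite `ℕ`-graded algebra `A`
with `GK(A) = d`, in the graded sense. -/
structure IsGradedNQR (ℬ : ℕ → Submodule k B) (𝒜 : ℕ → Submodule k A)
    (ℳ : ℤ → Submodule k M) (𝒩 : ℤ → Submodule k N) (d : ℕ) : Prop
    extends QuasiResolutionData k B A M N d where
  grading_base : IsLocallyFiniteGrading k 𝒜
  grading : IsLocallyFiniteGrading k ℬ
  graded_M : IsGradedBimodule ℬ 𝒜 ℳ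
  graded_N : IsGradedBimodule 𝒜 ℬ 𝒩
  isoB : GradedSIsomorphic ℬ ℬ (((d : ℝ) - 2 : ℝ) : EReal)
    (tensorGrading (A := A) ℳ 𝒩) (intGrading ℬ)
  isoA : GradedSIsomorphic 𝒜 𝒜 (((d : ℝ) - 2 : ℝ) : EReal)
    (tensorGrading (A := B) 𝒩 ℳ) (intGrading 𝒜)

end QuasiResolution

/-! ### The Peirce pieces `eBe`, `Be`, `eB` and the ideal `BeB` -/

section Peirce

variable {k : Type u} [Field k] {B : Type v} [Ring B] [Algebra k B]

/-- The left ideal `Be`. -/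
abbrev peirceLeft (e : B) : Submodule B B := Submodule.span B {e}

/-- The right ideal `eB`. -/
abbrev peirceRight (e : B) : Submodule Bᵐᵒᵖ B := Submodule.span Bᵐᵒᵖ {e}

/-- The two-sided ideal `BeB`, the right ideal generated by all `x e`. -/
def idealBeB (e : B) : Submodule Bᵐᵒᵖ B := Submodule.span Bᵐᵒᵖ (Set.range fun x : B => x * e)

theorem mem_peirceLeft {e : B} (he : IsIdempotentElem e) {x : B} :
    x ∈ peirceLeft e ↔ x * e = x := by
  rw [Submodule.mem_span_singleton]
  constructor
  · rintro ⟨b, rfl⟩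
    simp [mul_assoc, he.eq]
  · intro h
    exact ⟨x, h⟩

theorem mem_peirceRight {e : B} (he : IsIdempotentElem e) {x : B} :
    x ∈ peirceRight e ↔ e * x = x := by
  rw [Submodule.mem_span_singleton]
  constructor
  · rintro ⟨b, rfl⟩
    simp [← mul_assoc, he.eq]
  · intro h
    exact ⟨op x, h⟩

variable {e : B} (he : IsIdempotentElem e)

namespace Corner

theorem left_eq (a : he.Corner) : e * a.1 = a.1 := ((Subsemigroup.mem_corner_iff he).1 a.2).1

theorem right_eq (a : he.Corner) : a.1 * e = a.1 := ((Subsemigroup.mem_corner_iff he).1 a.2).2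

instance : Module k he.Corner where
  smul c a := ⟨c • a.1, (Subsemigroup.mem_corner_iff he).2
    ⟨by rw [mul_smul_comm, left_eq], by rw [smul_mul_assoc, right_eq]⟩⟩
  one_smul a := Subtype.ext (one_smul k a.1)
  mul_smul c c' a := Subtype.ext (mul_smul c c' a.1)
  smul_zero c := Subtype.ext (smul_zero (A := B) c)
  smul_add c a a' := Subtype.ext (smul_add c a.1 a'.1)
  add_smul c c' a := Subtype.ext (add_smul c c' a.1)
  zero_smul a := Subtype.ext (zero_smul k a.1)

/-- The `k`-algebra structure of `eBe`. -/
instance : Algebra k he.Corner :=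
  Algebra.ofModule (fun c a b => Subtype.ext (smul_mul_assoc c a.1 b.1))
    (fun c a b => Subtype.ext (mul_smul_comm c a.1 b.1))

/-- The inclusion of `eBe` in `B`. -/
def incl : he.Corner →ₗ[k] B where
  toFun a := a.1
  map_add' _ _ := rfl
  map_smul' _ _ := rfl

end Corner

/-- `Be` is a right `eBe`-module by multiplication. -/
instance : Module he.Cornerᵐᵒᵖ ↥(peirceLeft e) where
  smul a x := ⟨x.1 * (unop a).1, (mem_peirceLeft he).2 (by rw [mul_assoc, Corner.right_eq])⟩
  one_smul x := Subtype.ext ((mem_peirceLeft he).1 x.2)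
  mul_smul a b x := Subtype.ext (mul_assoc x.1 (unop b).1 (unop a).1).symm
  smul_zero a := Subtype.ext (zero_mul (unop a).1)
  smul_add a x y := Subtype.ext (add_mul x.1 y.1 (unop a).1)
  add_smul a b x := Subtype.ext (mul_add x.1 (unop a).1 (unop b).1)
  zero_smul x := Subtype.ext (mul_zero x.1)

instance : IsScalarTower k he.Cornerᵐᵒᵖ ↥(peirceLeft e) where
  smul_assoc c a x := Subtype.ext (mul_smul_comm c x.1 (unop a).1)

instance : SMulCommClass B he.Cornerᵐᵒᵖ ↥(peirceLeft e) where
  smul_comm b a x := Subtype.ext (mul_assoc b x.1 (unop a).1).symm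

/-- `eB` is a left `eBe`-module by multiplication. -/
instance : Module he.Corner ↥(peirceRight e) where
  smul a x := ⟨a.1 * x.1, (mem_peirceRight he).2 (by rw [← mul_assoc, Corner.left_eq])⟩
  one_smul x := Subtype.ext ((mem_peirceRight he).1 x.2)
  mul_smul a b x := Subtype.ext (mul_assoc a.1 b.1 x.1)
  smul_zero a := Subtype.ext (mul_zero a.1)
  smul_add a x y := Subtype.ext (mul_add a.1 x.1 y.1)
  add_smul a b x := Subtype.ext (add_mul a.1 b.1 x.1)
  zero_smul x := Subtype.ext (zero_mul x.1)

instance : IsScalarTower k he.Corner ↥(peirceRight e) where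
  smul_assoc c a x := Subtype.ext (smul_mul_assoc c a.1 x.1)

instance : SMulCommClass he.Corner Bᵐᵒᵖ ↥(peirceRight e) where
  smul_comm a b x := Subtype.ext (mul_assoc a.1 x.1 (unop b)).symm

/-- The grading of `eBe` induced from `B`. -/
def cornerGrading (ℬ : ℕ → Submodule k B) (i : ℕ) : Submodule k he.Corner :=
  (ℬ i).comap (Corner.incl he)

/-- The grading of `Be` induced from `B`. -/
def leftGrading (ℬ : ℕ → Submodule k B) (e : B) (i : ℤ) : Submodule k ↥(peirceLeft e) :=
  (intGrading ℬ i).comap ((peirceLeft e).subtype.restrictScalars k)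

/-- The grading of `eB` induced from `B`. -/
def rightGrading (ℬ : ℕ → Submodule k B) (e : B) (i : ℤ) : Submodule k ↥(peirceRight e) :=
  (intGrading ℬ i).comap ((peirceRight e).subtype.restrictScalars k)

end Peirce

end QuasiRes

/-!
The multiplication map `eB ⊗_B Be → eBe` is bijective, with inverse `a ↦ e ⊗ a`.  The
multiplication map `μ : Be ⊗_{eBe} eB → B` has image `BeB`, and `BeB` kills its kernel, because
`t · xy = μ(t)x ⊗ y` for `x ∈ Be` and `y ∈ eB`.  So the kernel and the cokernel of `μ` are finitely
generated right modules over `B / BeB`, whence both have GK-dimension at most `d - 2`, and both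
multiplication maps are `(d - 2)`-isomorphisms.

The corner `eBe` is noetherian because its left ideals are contracted from left ideals of `B`.
Being contained in `B`, it has GK-dimension at most `d`.  Conversely `Be` is a nonzero left ideal,
so `j(Be) = 0` and `GK(Be) = d` by the CM property, while `GK(Be) ≤ GK(eBe)` because `Be` is a
bimodule that is finitely generated over `eBe`.
-/

namespace QuasiRes

universe u v

section Growth

open Filter Topology

/-- The exponent of polynomial growth `limsup_n log_n (f n)` of a sequence of natural numbers, of
which the Gelfand-Kirillov dimension is a supremum.  Like there, `log_n (f n)` is the quotient of
the logarithms, with value `-∞` when `f n = 0`; only `n ≥ 2` matters. -/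
noncomputable def growthExponent (f : ℕ → ℕ) : EReal :=
  limsup (fun n : ℕ => ENNReal.log (f n : ℝ≥0∞) / ((Real.log n : ℝ) : EReal)) atTop

theorem limsup_const_div_log (x : ℝ) :
    limsup (fun n : ℕ => (x : EReal) / ((Real.log n : ℝ) : EReal)) atTop = 0 := by
  have hreal : Tendsto (fun n : ℕ => x / Real.log n) atTop (𝓝 0) :=
    tendsto_const_nhds.div_atTop (Real.tendsto_log_atTop.comp tendsto_natCast_atTop_atTop)
  have hereal := (continuous_coe_real_ereal.tendsto 0).comp hreal
  simpa only [Function.comp_def, EReal.coe_div, EReal.coe_zero] using hereal.limsup_eq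

theorem growthExponent_le_of_le_mul {f g : ℕ → ℕ} (c : ℕ) (h : ∀ n, f n ≤ c * g n) :
    growthExponent f ≤ growthExponent g := by
  have hlog : ENNReal.log ((c + 1 : ℕ) : ℝ≥0∞) = ((Real.log (c + 1 : ℕ) : ℝ) : EReal) := by
    rw [ENNReal.log_pos_real (by simp) (ENNReal.natCast_ne_top _), ENNReal.toReal_natCast]
  have hlimsup := limsup_const_div_log (Real.log (c + 1 : ℕ))
  rw [← hlog] at hlimsup
  have hpointwise (n : ℕ) : ENNReal.log (f n : ℝ≥0∞) / ((Real.log n : ℝ) : EReal) ≤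
      ENNReal.log ((c + 1 : ℕ) : ℝ≥0∞) / ((Real.log n : ℝ) : EReal) +
        ENNReal.log (g n : ℝ≥0∞) / ((Real.log n : ℝ) : EReal) := by
    have hn : (0 : EReal) ≤ ((Real.log n : ℝ) : EReal) := by
      exact_mod_cast Real.log_natCast_nonneg n
    have hfg : (f n : ℝ≥0∞) ≤ ((c + 1 : ℕ) : ℝ≥0∞) * (g n : ℝ≥0∞) := by
      exact_mod_cast (h n).trans (Nat.mul_le_mul_right _ c.le_succ)
    rw [← EReal.add_div_of_nonneg_right hn, ← ENNReal.log_mul_add]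
    exact EReal.div_le_div_right_of_nonneg hn (ENNReal.log_le_log hfg)
  calc growthExponent f ≤ _ := limsup_le_limsup (Eventually.of_forall hpointwise)
    _ ≤ _ := EReal.limsup_add_le (Or.inl (hlimsup.trans_ne EReal.zero_ne_bot))
      (Or.inl (hlimsup.trans_ne EReal.zero_ne_top))
    _ = growthExponent g := by rw [hlimsup, zero_add, growthExponent]

theorem growthExponent_zero : growthExponent 0 = ⊥ := by
  refine (limsup_congr (v := fun _ => (⊥ : EReal)) ?_).trans (limsup_const _)
  filter_upwards [eventually_gt_atTop 1] with n hn
  have hpos : (0 : ℝ) < Real.log n := Real.log_pos (by exact_mod_cast hn)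
  rw [Pi.zero_apply, Nat.cast_zero, ENNReal.log_zero]
  exact EReal.bot_div_of_pos_ne_top (by exact_mod_cast hpos) (EReal.coe_ne_top _)

end Growth

section GKDimension

variable {k : Type*} [Field k]
variable {R : Type*} [Ring R] [Algebra k R] {S : Type*} [Ring S] [Algebra k S]
variable {M : Type*} [AddCommGroup M] [Module k M] [Module R M] [IsScalarTower k R M]
variable {N : Type*} [AddCommGroup N] [Module k N]

theorem smul_eq_map₂_lsmul (V : Submodule k R) (F : Submodule k M) :
    V • F = Submodule.map₂ (Algebra.lsmul k k M : R →ₐ[k] Module.End k M).toLinearMap V F :=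
  le_antisymm (Submodule.smul_le.2 fun _ hr _ hm => Submodule.apply_mem_map₂ _ hr hm)
    (Submodule.map₂_le.2 fun _ hr _ hm => Submodule.smul_mem_smul hr hm)

theorem fg_smul {V : Submodule k R} {F : Submodule k M} (hV : V.FG) (hF : F.FG) : (V • F).FG := by
  rw [smul_eq_map₂_lsmul]
  exact hV.map₂ _ hF

theorem finiteDimensional_pow_smul {V : Submodule k R} {F : Submodule k M} (hV : V.FG) (hF : F.FG)
    (n : ℕ) : FiniteDimensional k ↥(V ^ n • F) :=
  Module.Finite.iff_fg.2 (fg_smul (hV.pow n) hF)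

theorem finrank_smul_le {V : Submodule k R} {F : Submodule k M} (hV : V.FG) (hF : F.FG) :
    Module.finrank k ↥(V • F) ≤ Module.finrank k V * Module.finrank k F := by
  have : FiniteDimensional k V := Module.Finite.iff_fg.2 hV
  have : FiniteDimensional k F := Module.Finite.iff_fg.2 hF
  rw [smul_eq_map₂_lsmul, TensorProduct.map₂_eq_range_lift_comp_mapIncl,
    ← Module.finrank_tensorProduct]
  exact LinearMap.finrank_range_le _

theorem pow_succ_smul (V : Submodule k R) (F : Submodule k M) (n : ℕ) :
    V ^ (n + 1) • F = V • V ^ n • F := by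
  rw [pow_succ', ← smul_eq_mul, Submodule.smul_assoc]

theorem map_smul_of_linearMap [Module R N] [IsScalarTower k R N] (φ : M →ₗ[R] N)
    (V : Submodule k R) (F : Submodule k M) :
    (V • F).map (φ.restrictScalars k) = V • F.map (φ.restrictScalars k) := by
  refine le_antisymm (Submodule.map_le_iff_le_comap.2 (Submodule.smul_le.2 fun r hr m hm => ?_))
    (Submodule.smul_le.2 ?_)
  · rw [Submodule.mem_comap, LinearMap.restrictScalars_apply, map_smul]
    exact Submodule.smul_mem_smul hr (Submodule.mem_map_of_mem hm)
  · rintro r hr _ ⟨m, hm, rfl⟩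
    exact ⟨r • m, Submodule.smul_mem_smul hr hm, map_smul φ r m⟩

theorem smul_smul_comm_le [Module S M] [IsScalarTower k S M] [SMulCommClass R S M]
    (V : Submodule k R) (W : Submodule k S) (X : Submodule k M) : V • W • X ≤ W • V • X := by
  refine Submodule.smul_le.2 fun r hr => ?_
  suffices W • X ≤ (W • V • X).comap (Algebra.lsmul k k M r) from fun m hm => this hm
  refine Submodule.smul_le.2 fun s hs x hx => ?_
  change r • s • x ∈ W • V • X
  rw [smul_comm r s x]
  exact Submodule.smul_mem_smul hs (Submodule.smul_mem_smul hr hx)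

theorem gkDim_le_iff {a : EReal} :
    gkDim k R M ≤ a ↔ ∀ (V : Submodule k R) (F : Submodule k M), 1 ∈ V → V.FG → F.FG →
      growthExponent (fun n => Module.finrank k ↥(V ^ n • F)) ≤ a := by
  simp only [gkDim, growthExponent, iSup_le_iff]

theorem gkDim_le_of_finrank_le [Module S N] [IsScalarTower k S N]
    (h : ∀ (V : Submodule k R) (F : Submodule k M), 1 ∈ V → V.FG → F.FG →
      ∃ (W : Submodule k S) (G : Submodule k N) (c : ℕ), 1 ∈ W ∧ W.FG ∧ G.FG ∧
        ∀ n, Module.finrank k ↥(V ^ n • F) ≤ c * Module.finrank k ↥(W ^ n • G)) :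
    gkDim k R M ≤ gkDim k S N := by
  refine gkDim_le_iff.2 fun V F hV1 hV hF => ?_
  obtain ⟨W, G, c, hW1, hW, hG, hle⟩ := h V F hV1 hV hF
  exact (growthExponent_le_of_le_mul c hle).trans (gkDim_le_iff.1 le_rfl W G hW1 hW hG)

theorem gkDim_of_subsingleton [Subsingleton M] : gkDim k R M = ⊥ :=
  le_bot_iff.1 <| gkDim_le_iff.2 fun V F _ _ _ => by
    have hzero : (fun n => Module.finrank k ↥(V ^ n • F)) = 0 :=
      funext fun _ => Module.finrank_zero_of_subsingleton
    rw [hzero, growthExponent_zero]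

theorem map_pow_smul_le [Module S N] [IsScalarTower k S N] {θ : R →ₗ[k] S} {φ : M →ₗ[k] N}
    (hθ : ∀ r m, φ (r • m) = θ r • φ m) {V : Submodule k R} {W : Submodule k S}
    (hVW : V.map θ ≤ W) (F : Submodule k M) (n : ℕ) : (V ^ n • F).map φ ≤ W ^ n • F.map φ := by
  induction n with
  | zero => rw [pow_zero, pow_zero, Submodule.one_smul, Submodule.one_smul]
  | succ n ih =>
    rw [pow_succ_smul, pow_succ_smul, Submodule.map_le_iff_le_comap]
    refine Submodule.smul_le.2 fun r hr m hm => ?_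
    rw [Submodule.mem_comap, hθ]
    exact Submodule.smul_mem_smul (hVW (Submodule.mem_map_of_mem hr))
      (ih (Submodule.mem_map_of_mem hm))

/-- The map `θ` need not preserve `1`: the inclusion of a corner does not. -/
theorem gkDim_le_of_injective [Module S N] [IsScalarTower k S N] (θ : R →ₗ[k] S) (φ : M →ₗ[k] N)
    (hφ : Function.Injective φ) (hθ : ∀ r m, φ (r • m) = θ r • φ m) :
    gkDim k R M ≤ gkDim k S N := by
  refine gkDim_le_of_finrank_le fun V F _ hV hF => ?_
  have hW : (V.map θ ⊔ Submodule.span k {1}).FG := (hV.map θ).sup (Submodule.fg_span_singleton 1)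
  refine ⟨_, F.map φ, 1, Submodule.mem_sup_right (Submodule.mem_span_singleton_self 1), hW,
    hF.map φ, fun n => ?_⟩
  have := finiteDimensional_pow_smul hW (hF.map φ) n
  rw [one_mul, (Submodule.equivMapOfInjective φ hφ _).finrank_eq]
  exact Submodule.finrank_mono (map_pow_smul_le hθ le_sup_left F n)

theorem exists_fg_map_eq {φ : M →ₗ[k] N} (hφ : Function.Surjective φ) {G : Submodule k N}
    (hG : G.FG) : ∃ F : Submodule k M, F.FG ∧ F.map φ = G := by
  obtain ⟨s, hs, rfl⟩ := Submodule.fg_def.1 hG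
  refine ⟨Submodule.span k (Function.surjInv hφ '' s), Submodule.fg_span (hs.image _), ?_⟩
  rw [Submodule.map_span, (Function.rightInverse_surjInv hφ).leftInverse.image_image]

theorem gkDim_le_of_surjective [Module R N] [IsScalarTower k R N] (φ : M →ₗ[R] N)
    (hφ : Function.Surjective φ) : gkDim k R N ≤ gkDim k R M := by
  refine gkDim_le_of_finrank_le fun V G hV1 hV hG => ?_
  obtain ⟨F, hF, rfl⟩ := exists_fg_map_eq (φ := φ.restrictScalars k) hφ hG
  refine ⟨V, F, 1, hV1, hV, hF, fun n => ?_⟩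
  have := finiteDimensional_pow_smul hV hF n
  rw [one_mul, ← map_smul_of_linearMap]
  exact Submodule.finrank_map_le _ _

theorem finrank_le_card_mul_of_map_proj_le {ι : Type*} [Fintype ι] {P : Submodule k (ι → N)}
    {Q : Submodule k N} [FiniteDimensional k Q] (h : ∀ i, P.map (LinearMap.proj i) ≤ Q) :
    Module.finrank k P ≤ Fintype.card ι * Module.finrank k Q := by
  let ψ : P →ₗ[k] ι → Q := LinearMap.pi fun i =>
    (LinearMap.proj i ∘ₗ P.subtype).codRestrict Q fun x => h i (Submodule.mem_map_of_mem x.2)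
  have hψ : Function.Injective ψ := fun x y hxy =>
    Subtype.ext (funext fun i => congrArg Subtype.val (congrFun hxy i))
  simpa [Module.finrank_pi_fintype] using LinearMap.finrank_le_finrank_of_injective hψ

theorem gkDim_pi_le (ι : Type*) [Finite ι] : gkDim k R (ι → M) ≤ gkDim k R M := by
  have := Fintype.ofFinite ι
  refine gkDim_le_of_finrank_le fun V F hV1 hV hF => ?_
  let G : Submodule k M := ⨆ i, F.map (LinearMap.proj i)
  have hG : G.FG := Submodule.fg_iSup _ fun i => hF.map _
  refine ⟨V, G, Fintype.card ι, hV1, hV, hG, fun n => ?_⟩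
  have := finiteDimensional_pow_smul hV hG n
  refine finrank_le_card_mul_of_map_proj_le fun i => ?_
  exact (map_smul_of_linearMap (LinearMap.proj i : (ι → M) →ₗ[R] M) (V ^ n) F).le.trans
    (Submodule.smul_mono le_rfl (le_iSup (fun i => F.map (LinearMap.proj i)) i))

theorem gkDim_le_of_forall_mem_range [Module R N] [IsScalarTower k R N] [Module.Finite R N]
    (h : ∀ y : N, ∃ φ : M →ₗ[R] N, y ∈ LinearMap.range φ) : gkDim k R N ≤ gkDim k R M := by
  obtain ⟨l, g, hg⟩ := Module.Finite.exists_fin (R := R) (M := N)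
  choose φ hφ using fun i => h (g i)
  let Φ : (Fin l → M) →ₗ[R] N := LinearMap.lsum R (fun _ => M) ℕ φ
  have hrange : LinearMap.range Φ = ⊤ := by
    refine top_le_iff.1 (hg.ge.trans (Submodule.span_le.2 ?_))
    rintro _ ⟨i, rfl⟩
    obtain ⟨x, hx⟩ := hφ i
    exact ⟨Pi.single i x, (LinearMap.lsum_piSingle _ _ _ _ _ _).trans hx⟩
  exact (gkDim_le_of_surjective Φ (LinearMap.range_eq_top.1 hrange)).trans (gkDim_pi_le _)

theorem exists_fg_mem_smul [Module S N] [IsScalarTower k S N] {X : Submodule k N} {y : N}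
    (hy : y ∈ Submodule.span S (X : Set N)) : ∃ W : Submodule k S, W.FG ∧ y ∈ W • X := by
  induction hy using Submodule.span_induction with
  | mem y hy =>
    refine ⟨Submodule.span k {1}, Submodule.fg_span_singleton 1, ?_⟩
    rw [← one_smul S y]
    exact Submodule.smul_mem_smul (Submodule.mem_span_singleton_self 1) hy
  | zero => exact ⟨⊥, Submodule.fg_bot, zero_mem _⟩
  | add y z _ _ hy hz =>
    obtain ⟨W, hW, hyW⟩ := hy
    obtain ⟨W', hW', hzW'⟩ := hz
    exact ⟨W ⊔ W', hW.sup hW', add_mem (Submodule.smul_mono le_sup_left le_rfl hyW)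
      (Submodule.smul_mono le_sup_right le_rfl hzW')⟩
  | smul s y _ hy =>
    obtain ⟨W, hW, hyW⟩ := hy
    refine ⟨Submodule.span k {s} • W, fg_smul (Submodule.fg_span_singleton s) hW, ?_⟩
    rw [Submodule.smul_assoc]
    exact Submodule.smul_mem_smul (Submodule.mem_span_singleton_self s) hyW

theorem exists_fg_le_smul [Module S N] [IsScalarTower k S N] {X : Submodule k N}
    (hX : Submodule.span S (X : Set N) = ⊤) {F : Submodule k N} (hF : F.FG) :
    ∃ W : Submodule k S, 1 ∈ W ∧ W.FG ∧ F ≤ W • X := by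
  induction F, hF using Submodule.fg_induction with
  | singleton y =>
    obtain ⟨W, hW, hy⟩ := exists_fg_mem_smul (X := X) (y := y) (hX ▸ Submodule.mem_top)
    refine ⟨Submodule.span k {1} ⊔ W,
      Submodule.mem_sup_left (Submodule.mem_span_singleton_self 1),
      (Submodule.fg_span_singleton 1).sup hW, ?_⟩
    exact (Submodule.span_singleton_le_iff_mem _ _).2 (Submodule.smul_mono le_sup_right le_rfl hy)
  | sup F F' _ _ hF hF' =>
    obtain ⟨W, hW1, hW, hle⟩ := hF
    obtain ⟨W', _, hW', hle'⟩ := hF'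
    exact ⟨W ⊔ W', Submodule.mem_sup_left hW1, hW.sup hW',
      sup_le (hle.trans (Submodule.smul_mono le_sup_left le_rfl))
        (hle'.trans (Submodule.smul_mono le_sup_right le_rfl))⟩

theorem pow_smul_le_pow_smul [Module S M] [IsScalarTower k S M] [SMulCommClass R S M]
    {V : Submodule k R} {W : Submodule k S} {X : Submodule k M} (h : V • X ≤ W • X) (n : ℕ) :
    V ^ n • X ≤ W ^ n • X := by
  induction n with
  | zero => rw [pow_zero, pow_zero, Submodule.one_smul, Submodule.one_smul]
  | succ n ih =>
    calc V ^ (n + 1) • X = V • V ^ n • X := pow_succ_smul V X n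
      _ ≤ V • W ^ n • X := Submodule.smul_mono le_rfl ih
      _ ≤ W ^ n • V • X := smul_smul_comm_le V (W ^ n) X
      _ ≤ W ^ n • W • X := Submodule.smul_mono le_rfl h
      _ = W ^ (n + 1) • X := by rw [pow_succ, ← smul_eq_mul, Submodule.smul_assoc]

theorem gkDim_le_of_finite_bimodule [Module S M] [IsScalarTower k S M] [SMulCommClass R S M]
    [Module.Finite S M] : gkDim k R M ≤ gkDim k S S := by
  obtain ⟨s, hs⟩ := Module.Finite.fg_top (R := S) (M := M)
  refine gkDim_le_of_finrank_le fun V F _ hV hF => ?_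
  let X : Submodule k M := Submodule.span k s
  have hX : X.FG := ⟨s, rfl⟩
  have hspan : Submodule.span S (X : Set M) = ⊤ := by rw [Submodule.span_span_of_tower, hs]
  obtain ⟨W, hW1, hW, hle⟩ := exists_fg_le_smul hspan (hF.sup (fg_smul hV hX))
  obtain ⟨hFW, hVW⟩ := sup_le_iff.1 hle
  refine ⟨W, W, Module.finrank k X, hW1, hW, hW, fun n => ?_⟩
  have hgrowth : V ^ n • F ≤ (W ^ n • W) • X := calc
    V ^ n • F ≤ V ^ n • W • X := Submodule.smul_mono le_rfl hFW
    _ ≤ W • V ^ n • X := smul_smul_comm_le (V ^ n) W X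
    _ ≤ W • W ^ n • X := Submodule.smul_mono le_rfl (pow_smul_le_pow_smul hVW n)
    _ = (W ^ n • W) • X := by
      rw [← pow_succ_smul, pow_succ, ← smul_eq_mul]
  have := Module.Finite.iff_fg.2 (fg_smul (fg_smul (hW.pow n) hW) hX)
  calc Module.finrank k ↥(V ^ n • F) ≤ Module.finrank k ↥((W ^ n • W) • X) :=
        Submodule.finrank_mono hgrowth
    _ ≤ Module.finrank k ↥(W ^ n • W) * Module.finrank k X :=
        finrank_smul_le (fg_smul (hW.pow n) hW) hX
    _ = Module.finrank k X * Module.finrank k ↥(W ^ n • W) := mul_comm _ _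

end GKDimension

section Orbit

variable {k : Type*} [Field k] {B : Type*} [Ring B] [Algebra k B]
  {X : Type*} [AddCommGroup X] [Module k X] [Module Bᵐᵒᵖ X] [IsScalarTower k Bᵐᵒᵖ X]

/-- The map `b ↦ x b` of right modules from `B` onto the cyclic submodule generated by `x`; its
kernel is the right annihilator of `x`. -/
def orbitMap {B X : Type*} [Ring B] [AddCommGroup X] [Module Bᵐᵒᵖ X] (x : X) : B →ₗ[Bᵐᵒᵖ] X where
  toFun b := op b • x
  map_add' b c := add_smul (op b) (op c) x
  map_smul' c b := mul_smul c (op b) x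

theorem gkDim_le_of_le_ker_orbitMap [Module.Finite Bᵐᵒᵖ X] {I : Submodule Bᵐᵒᵖ B}
    (h : ∀ x : X, I ≤ LinearMap.ker (orbitMap x)) : gkDim k Bᵐᵒᵖ X ≤ gkDim k Bᵐᵒᵖ (B ⧸ I) :=
  gkDim_le_of_forall_mem_range fun x => ⟨I.liftQ (orbitMap x) (h x), I.mkQ 1, one_smul Bᵐᵒᵖ x⟩

end Orbit

section Grade

open CategoryTheory CategoryTheory.Abelian

theorem gradeNumber_eq_zero {R : Type v} [Ring R] {M : Type v} [AddCommGroup M] [Module R M]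
    {f : M →ₗ[R] R} (hf : f ≠ 0) : gradeNumber R M = 0 := by
  have : Nontrivial (ExtRing R M 0) := by
    refine ⟨Ext.mk₀ (ModuleCat.ofHom f), 0, fun h => hf ?_⟩
    simpa using congrArg ModuleCat.Hom.hom ((Ext.mk₀_eq_zero_iff _).1 h)
  exact le_antisymm (iInf₂_le_of_le 0 this le_rfl) bot_le

theorem LeftCM.gkDim_eq_of_ne_zero {k : Type u} [Field k] {R : Type v} [Ring R] [Algebra k R]
    {d : ℕ} (h : LeftCM R k d) {M : Type v} [AddCommGroup M] [Module k M] [Module R M]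
    [IsScalarTower k R M] [Module.Finite R M] {f : M →ₗ[R] R} (hf : f ≠ 0) :
    gkDim k R M = d := by
  have : Nontrivial M := by
    obtain ⟨x, hx⟩ := DFunLike.ne_iff.1 hf
    exact ⟨x, 0, fun h0 => hx (by rw [h0, map_zero, map_zero])⟩
  simpa only [gradeNumber_eq_zero hf, ENat.toENNReal_zero, EReal.coe_ennreal_zero, zero_add]
    using h M

end Grade

namespace BalTensor

section Lift

variable {k : Type*} [Field k] {A : Type*} [Ring A]
  {M : Type*} [AddCommGroup M] [Module k M] [Module Aᵐᵒᵖ M]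
  {N : Type*} [AddCommGroup N] [Module k N] [Module A N]

theorem tmul_add (m : M) (n n' : N) : tmul k A m (n + n') = tmul k A m n + tmul k A m n' := by
  simp only [tmul, TensorProduct.tmul_add, map_add]

theorem add_tmul (m m' : M) (n : N) : tmul k A (m + m') n = tmul k A m n + tmul k A m' n := by
  simp only [tmul, TensorProduct.add_tmul, map_add]

theorem zero_tmul (n : N) : tmul k A (0 : M) n = 0 := by
  rw [tmul, TensorProduct.zero_tmul, map_zero]

theorem smul_tmul (m : M) (a : A) (n : N) : tmul k A (op a • m) n = tmul k A m (a • n) :=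
  (Submodule.Quotient.eq _).2 (Submodule.subset_span ⟨m, a, n, rfl⟩)

variable [Algebra k A] [IsScalarTower k Aᵐᵒᵖ M] [IsScalarTower k A N]

@[elab_as_elim]
theorem induction_on {p : BalTensor k A M N → Prop} (t : BalTensor k A M N)
    (tmul : ∀ m n, p (tmul k A m n)) (add : ∀ x y, p x → p y → p (x + y)) : p t := by
  obtain ⟨t, rfl⟩ := mk_surjective k A M N t
  induction t using TensorProduct.induction_on with
  | zero => simpa only [BalTensor.tmul, TensorProduct.zero_tmul] using tmul 0 0
  | tmul m n => exact tmul m n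
  | add x y hx hy => rw [map_add]; exact add _ _ hx hy

variable {P : Type*} [AddCommGroup P] [Module k P]

/-- The linear map on `M ⊗_A N` induced by a balanced bilinear map: the universal property. -/
def lift (β : M →ₗ[k] N →ₗ[k] P) (hβ : ∀ m (a : A) n, β (op a • m) n = β m (a • n)) :
    BalTensor k A M N →ₗ[k] P :=
  (balancedRel k A M N).liftQ (TensorProduct.lift β) <| by
    refine Submodule.span_le.2 ?_
    rintro _ ⟨m, a, n, rfl⟩
    rw [SetLike.mem_coe, LinearMap.mem_ker, map_sub, TensorProduct.lift.tmul,
      TensorProduct.lift.tmul, hβ, sub_self]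

variable {E : Type*} [Ring E] [Algebra k E] [Module Eᵐᵒᵖ N] [IsScalarTower k Eᵐᵒᵖ N]
  [SMulCommClass A Eᵐᵒᵖ N]

/-- `BalTensor.lift` as a map of right modules, when the bilinear map is right linear in the second
variable. -/
def liftRight [Module Eᵐᵒᵖ P] (β : M →ₗ[k] N →ₗ[k] P)
    (hβ : ∀ m (a : A) n, β (op a • m) n = β m (a • n))
    (hE : ∀ m (c : Eᵐᵒᵖ) n, β m (c • n) = c • β m n) : BalTensor k A M N →ₗ[Eᵐᵒᵖ] P where
  toFun := lift β hβ
  map_add' := map_add _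
  map_smul' c t := by
    induction t using induction_on with
    | tmul m n => exact hE m c n
    | add x y hx hy => rw [smul_add, map_add, hx, hy, map_add, smul_add]

section LiftRight

variable [Module Eᵐᵒᵖ P] {β : M →ₗ[k] N →ₗ[k] P} {hβ : ∀ m (a : A) n, β (op a • m) n = β m (a • n)}
  {hE : ∀ m (c : Eᵐᵒᵖ) n, β m (c • n) = c • β m n}

theorem liftRight_smul_left {D : Type*} [Ring D] [Algebra k D] [Module D M] [IsScalarTower k D M]
    [SMulCommClass D Aᵐᵒᵖ M] [Module D P] (hD : ∀ (b : D) m n, β (b • m) n = b • β m n) (b : D)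
    (t : BalTensor k A M N) : liftRight β hβ hE (b • t) = b • liftRight β hβ hE t := by
  induction t using induction_on with
  | tmul m n => exact hD b m n
  | add x y hx hy => rw [smul_add, map_add, hx, hy, map_add, smul_add]

theorem liftRight_mem {ℳ : ℤ → Submodule k M} {𝒩 : ℤ → Submodule k N} {𝒬 : ℤ → Submodule k P}
    (h : ∀ p q, ∀ m ∈ ℳ p, ∀ n ∈ 𝒩 q, β m n ∈ 𝒬 (p + q)) (i : ℤ) {t : BalTensor k A M N}
    (ht : t ∈ tensorGrading ℳ 𝒩 i) : liftRight β hβ hE t ∈ 𝒬 i := by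
  suffices tensorGrading ℳ 𝒩 i ≤ (𝒬 i).comap (lift β hβ) from this ht
  refine Submodule.span_le.2 ?_
  rintro _ ⟨p, q, rfl, m, hm, n, hn, rfl⟩
  exact h p q m hm n hn

end LiftRight

variable (k) in
/-- The map `n ↦ m ⊗ n` of right modules. -/
def tmulRight (m : M) : N →ₗ[Eᵐᵒᵖ] BalTensor k A M N where
  toFun := tmul k A m
  map_add' := tmul_add m
  map_smul' c n := (smul_tmul_right k A M N E c m n).symm

variable (k A M N E) in
theorem finite_right [Module.Finite Aᵐᵒᵖ M] [Module.Finite Eᵐᵒᵖ N] :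
    Module.Finite Eᵐᵒᵖ (BalTensor k A M N) := by
  obtain ⟨l, g, hg⟩ := Module.Finite.exists_fin (R := Aᵐᵒᵖ) (M := M)
  let Q : Submodule Eᵐᵒᵖ (BalTensor k A M N) := ⨆ i, LinearMap.range (tmulRight k (g i))
  have htmul (m : M) : ∀ n : N, tmul k A m n ∈ Q := by
    have hm : m ∈ Submodule.span Aᵐᵒᵖ (Set.range g) := hg ▸ Submodule.mem_top
    induction hm using Submodule.span_induction with
    | mem _ hm =>
      obtain ⟨i, rfl⟩ := hm
      exact fun n => Submodule.mem_iSup_of_mem i ⟨n, rfl⟩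
    | zero => exact fun n => by rw [zero_tmul]; exact zero_mem Q
    | add m m' _ _ hm hm' => exact fun n => by rw [add_tmul]; exact add_mem (hm n) (hm' n)
    | smul a m _ hm => exact fun n => by rw [← op_unop a, smul_tmul]; exact hm _
  have hQ : Q = ⊤ := by
    refine Submodule.eq_top_iff'.2 fun t => ?_
    induction t using induction_on with
    | tmul m n => exact htmul m n
    | add x y hx hy => exact add_mem hx hy
  refine ⟨hQ ▸ Submodule.fg_iSup _ fun i => ?_⟩
  exact Module.Finite.iff_fg.1 (Module.Finite.range (tmulRight k (g i)))

end Lift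

end BalTensor

section SIsomorphism

variable {k : Type u} [Field k] {D A : Type*} [Ring D] [Algebra k D] [Ring A] [Algebra k A]
  {s : EReal}

theorem isSIso_of_bijective {X P : Type*}
    [AddCommGroup X] [Module k X] [Module Aᵐᵒᵖ X] [IsScalarTower k Aᵐᵒᵖ X]
    [AddCommGroup P] [Module k P] [Module Aᵐᵒᵖ P] [IsScalarTower k Aᵐᵒᵖ P]
    {f : X →ₗ[Aᵐᵒᵖ] P} (hf : Function.Bijective f) : IsSIso k A s f := by
  have : Subsingleton ↥(LinearMap.ker f) :=
    Submodule.subsingleton_iff_eq_bot.2 (LinearMap.ker_eq_bot.2 hf.1)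
  have : Subsingleton (P ⧸ LinearMap.range f) :=
    Submodule.Quotient.subsingleton_iff.2 (LinearMap.range_eq_top.2 hf.2)
  exact ⟨gkDim_of_subsingleton.trans_le bot_le, gkDim_of_subsingleton.trans_le bot_le⟩

variable {X Y : Type v}
  [AddCommGroup X] [Module k X] [Module D X] [Module Aᵐᵒᵖ X]
  [IsScalarTower k D X] [IsScalarTower k Aᵐᵒᵖ X] [SMulCommClass D Aᵐᵒᵖ X]
  [AddCommGroup Y] [Module k Y] [Module D Y] [Module Aᵐᵒᵖ Y]
  [IsScalarTower k D Y] [IsScalarTower k Aᵐᵒᵖ Y] [SMulCommClass D Aᵐᵒᵖ Y]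
  {f : X →ₗ[Aᵐᵒᵖ] Y}

theorem SIsomorphic.of_isSIso (hf : IsSIso k A s f) (hD : ∀ (b : D) (x : X), f (b • x) = b • f x) :
    SIsomorphic k D A s X Y :=
  ⟨Y, inferInstance, inferInstance, inferInstance, inferInstance, inferInstance, inferInstance,
    inferInstance, f, LinearMap.id, hD, fun _ _ => rfl, hf,
    isSIso_of_bijective Function.bijective_id⟩

theorem GradedSIsomorphic.of_isSIso {𝒟 : ℕ → Submodule k D} {𝒜 : ℕ → Submodule k A}
    {𝒳 : ℤ → Submodule k X} {𝒴 : ℤ → Submodule k Y} (h𝒴 : IsGradedBimodule 𝒟 𝒜 𝒴)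
    (hf : IsSIso k A s f) (hD : ∀ (b : D) (x : X), f (b • x) = b • f x)
    (hdeg : ∀ i, ∀ x ∈ 𝒳 i, f x ∈ 𝒴 i) : GradedSIsomorphic 𝒟 𝒜 s 𝒳 𝒴 :=
  ⟨Y, inferInstance, inferInstance, inferInstance, inferInstance, inferInstance, inferInstance,
    inferInstance, 𝒴, f, LinearMap.id, h𝒴, hD, fun _ _ => rfl, hdeg, fun _ _ => id, hf,
    isSIso_of_bijective Function.bijective_id⟩

end SIsomorphism

section Corner

namespace Corner

variable {B : Type*} [Ring B] {e : B} (he : IsIdempotentElem e)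

/-- The projection `b ↦ ebe` of `B` onto `eBe`. -/
def proj : B →+ he.Corner where
  toFun b := ⟨e * b * e, (Subsemigroup.mem_corner_iff he).2
    ⟨by rw [← mul_assoc, ← mul_assoc, he.eq], by rw [mul_assoc, he.eq]⟩⟩
  map_zero' := Subtype.ext (show e * 0 * e = 0 by rw [mul_zero, zero_mul])
  map_add' x y := Subtype.ext (show e * (x + y) * e = e * x * e + e * y * e by
    rw [mul_add, add_mul])

theorem proj_coe (a : he.Corner) : proj he a.1 = a :=
  Subtype.ext (show e * a.1 * e = a.1 by rw [left_eq, right_eq])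

theorem proj_mul_coe (b : B) (a : he.Corner) : proj he (b * a.1) = proj he b * a :=
  Subtype.ext (show e * (b * a.1) * e = e * b * e * a.1 by
    rw [mul_assoc (e * b), left_eq, ← mul_assoc, mul_assoc, right_eq])

/-- The left ideal of `B` coextended from a left ideal `I` of `eBe`: the largest left ideal `J` with
`eJe ⊆ I`. -/
def coextend (I : Ideal he.Corner) : Ideal B where
  carrier := {b | ∀ c, proj he (c * b) ∈ I}
  zero_mem' c := by rw [mul_zero, map_zero]; exact I.zero_mem
  add_mem' hx hy c := by rw [mul_add, map_add]; exact I.add_mem (hx c) (hy c)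
  smul_mem' a b hb c := by rw [smul_eq_mul, ← mul_assoc]; exact hb (c * a)

theorem coe_mem_coextend {I : Ideal he.Corner} {a : he.Corner} : a.1 ∈ coextend he I ↔ a ∈ I := by
  refine ⟨fun h => ?_, fun ha c => ?_⟩
  · simpa only [one_mul, proj_coe] using h 1
  · rw [proj_mul_coe]
    exact I.mul_mem_left _ ha

theorem isNoetherianRing [IsNoetherianRing B] : IsNoetherianRing he.Corner := by
  have hmono : Monotone (coextend he) := fun I J h b hb c => h (hb c)
  have hinj : Function.Injective (coextend he) := fun I J h => by
    ext a
    rw [← coe_mem_coextend, h, coe_mem_coextend]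
  exact isNoetherian_iff'.2 (hmono.strictMono_of_injective hinj).wellFoundedGT

/-- The corner of the opposite ring is the opposite ring of the corner. -/
def opEquiv (he' : IsIdempotentElem (op e)) : he'.Corner ≃+* he.Cornerᵐᵒᵖ where
  toFun a := op ⟨unop a.1, (Subsemigroup.mem_corner_iff he).2
    ⟨congrArg unop (right_eq he' a), congrArg unop (left_eq he' a)⟩⟩
  invFun a := ⟨op (unop a).1, (Subsemigroup.mem_corner_iff he').2
    ⟨congrArg op (right_eq he (unop a)), congrArg op (left_eq he (unop a))⟩⟩
  left_inv _ := rfl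
  right_inv _ := rfl
  map_mul' _ _ := rfl
  map_add' _ _ := rfl

theorem isNoetherianRing_op [IsNoetherianRing Bᵐᵒᵖ] : IsNoetherianRing he.Cornerᵐᵒᵖ := by
  have he' : IsIdempotentElem (op e) := congrArg op he.eq
  have := isNoetherianRing he'
  exact isNoetherianRing_of_ringEquiv _ (opEquiv he he')

end Corner

variable {k : Type u} [Field k] {B : Type v} [Ring B] [Algebra k B] {e : B}

theorem gkDim_op_le_gkDim_self {R : Type*} [Ring R] [Algebra k R] :
    gkDim k Rᵐᵒᵖ Rᵐᵒᵖ ≤ gkDim k Rᵐᵒᵖ R :=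
  gkDim_le_of_injective LinearMap.id (opLinearEquiv k).symm.toLinearMap
    (opLinearEquiv k).symm.injective fun _ _ => rfl

instance (he : IsIdempotentElem e) : IsScalarTower k he.Cornerᵐᵒᵖ he.Corner where
  smul_assoc c a x := Subtype.ext (mul_smul_comm c x.1 (unop a).1)

theorem gkDim_corner_le (he : IsIdempotentElem e) :
    gkDim k he.Cornerᵐᵒᵖ he.Corner ≤ gkDim k Bᵐᵒᵖ B :=
  gkDim_le_of_injective
    ((opLinearEquiv k).toLinearMap ∘ₗ Corner.incl he ∘ₗ (opLinearEquiv k).symm.toLinearMap)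
    (Corner.incl he) Subtype.val_injective fun _ _ => rfl

theorem ne_zero_of_gkDim_quotient_lt (h : gkDim k Bᵐᵒᵖ (B ⧸ idealBeB e) < gkDim k Bᵐᵒᵖ B) :
    e ≠ 0 := by
  rintro rfl
  have hbot : idealBeB (0 : B) = ⊥ := by
    rw [idealBeB, Submodule.span_eq_bot]
    rintro _ ⟨x, rfl⟩
    exact mul_zero x
  have hinj : Function.Injective (idealBeB (0 : B)).mkQ :=
    LinearMap.ker_eq_bot.1 ((Submodule.ker_mkQ _).trans hbot)
  exact h.not_ge (gkDim_le_of_injective LinearMap.id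
    ((idealBeB (0 : B)).mkQ.restrictScalars k) hinj fun _ _ => rfl)

theorem IsCohenMacaulay.gkDim_corner {d : ℕ} (h : IsCohenMacaulay B k d) (he : IsIdempotentElem e)
    [Module.Finite he.Cornerᵐᵒᵖ ↥(peirceLeft e)] (he0 : e ≠ 0) :
    gkDim k he.Cornerᵐᵒᵖ he.Corner = d := by
  let e' : ↥(peirceLeft e) := ⟨e, Submodule.mem_span_singleton_self e⟩
  have hincl : (peirceLeft e).subtype ≠ 0 := fun h0 => he0 (LinearMap.congr_fun h0 e')
  refine le_antisymm ((gkDim_corner_le he).trans h.gkDim_eq.le) ?_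
  calc (d : EReal) = gkDim k B ↥(peirceLeft e) := (h.left_cm.gkDim_eq_of_ne_zero hincl).symm
    _ ≤ gkDim k he.Cornerᵐᵒᵖ he.Cornerᵐᵒᵖ := gkDim_le_of_finite_bimodule
    _ ≤ gkDim k he.Cornerᵐᵒᵖ he.Corner := gkDim_op_le_gkDim_self

end Corner

section Multiplication

/-- The product of elements of `eB` and `Be`, as an element of `eBe`. -/
def peirceMul {B : Type*} [Ring B] {e : B} (he : IsIdempotentElem e) (x : ↥(peirceRight e))
    (y : ↥(peirceLeft e)) : he.Corner :=
  ⟨x.1 * y.1, (Subsemigroup.mem_corner_iff he).2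
    ⟨by rw [← mul_assoc, (mem_peirceRight he).1 x.2],
      by rw [mul_assoc, (mem_peirceLeft he).1 y.2]⟩⟩

variable (k : Type u) [Field k] {B : Type v} [Ring B] [Algebra k B] {e : B}
  (he : IsIdempotentElem e)

/-- The multiplication map `Be ⊗ eB → B` over `eBe`. -/
def mulToRing : BalTensor k he.Corner ↥(peirceLeft e) ↥(peirceRight e) →ₗ[Bᵐᵒᵖ] B :=
  BalTensor.liftRight
    (LinearMap.mk₂ k (fun (x : ↥(peirceLeft e)) (y : ↥(peirceRight e)) => x.1 * y.1)
      (fun x x' y => add_mul x.1 x'.1 y.1) (fun c x y => smul_mul_assoc c x.1 y.1)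
      (fun x y y' => mul_add x.1 y.1 y'.1) (fun c x y => mul_smul_comm c x.1 y.1))
    (fun x a y => mul_assoc x.1 a.1 y.1) (fun x c y => (mul_assoc x.1 y.1 (unop c)).symm)

/-- The multiplication map `eB ⊗ Be → eBe` over `B`. -/
def mulToCorner : BalTensor k B ↥(peirceRight e) ↥(peirceLeft e) →ₗ[he.Cornerᵐᵒᵖ] he.Corner :=
  BalTensor.liftRight
    (LinearMap.mk₂ k (peirceMul he)
      (fun x x' y => Subtype.ext (add_mul x.1 x'.1 y.1))
      (fun c x y => Subtype.ext (smul_mul_assoc c x.1 y.1))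
      (fun x y y' => Subtype.ext (mul_add x.1 y.1 y'.1))
      (fun c x y => Subtype.ext (mul_smul_comm c x.1 y.1)))
    (fun x b y => Subtype.ext (mul_assoc x.1 b y.1))
    (fun x c y => Subtype.ext (mul_assoc x.1 y.1 (unop c).1).symm)

theorem mulToRing_tmul (x : ↥(peirceLeft e)) (y : ↥(peirceRight e)) :
    mulToRing k he (BalTensor.tmul k he.Corner x y) = x.1 * y.1 := rfl

theorem mulToRing_smul (b : B) (t : BalTensor k he.Corner ↥(peirceLeft e) ↥(peirceRight e)) :
    mulToRing k he (b • t) = b • mulToRing k he t :=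
  BalTensor.liftRight_smul_left (fun b x y => mul_assoc b x.1 y.1) b t

theorem mulToCorner_smul (a : he.Corner) (t : BalTensor k B ↥(peirceRight e) ↥(peirceLeft e)) :
    mulToCorner k he (a • t) = a • mulToCorner k he t :=
  BalTensor.liftRight_smul_left (P := he.Corner)
    (fun a x y => Subtype.ext (mul_assoc a.1 x.1 y.1)) a t

theorem op_mul_smul_eq_tmul (x : ↥(peirceLeft e)) (y : ↥(peirceRight e))
    (t : BalTensor k he.Corner ↥(peirceLeft e) ↥(peirceRight e)) :
    op (x.1 * y.1) • t = BalTensor.tmul k he.Corner (mulToRing k he t • x) y := by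
  induction t using BalTensor.induction_on with
  | tmul x' y' =>
    have hleft : op (x.1 * y.1) • y' = peirceMul he y' x • y :=
      Subtype.ext (mul_assoc y'.1 x.1 y.1).symm
    have hright : (x'.1 * y'.1) • x = op (peirceMul he y' x) • x' :=
      Subtype.ext (mul_assoc x'.1 y'.1 x.1)
    rw [BalTensor.smul_tmul_right, hleft, mulToRing_tmul, hright, BalTensor.smul_tmul]
  | add t t' h h' => rw [smul_add, h, h', map_add, add_smul, BalTensor.add_tmul]

theorem idealBeB_le_ker_orbitMap {t : BalTensor k he.Corner ↥(peirceLeft e) ↥(peirceRight e)}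
    (ht : mulToRing k he t = 0) : idealBeB e ≤ LinearMap.ker (orbitMap t) := by
  refine Submodule.span_le.2 ?_
  rintro _ ⟨x, rfl⟩
  let e' : ↥(peirceRight e) := ⟨e, Submodule.mem_span_singleton_self e⟩
  let xe : ↥(peirceLeft e) := ⟨x * e, (mem_peirceLeft he).2 (by rw [mul_assoc, he.eq])⟩
  calc op (x * e) • t = op (xe.1 * e'.1) • t := by rw [mul_assoc, he.eq]
    _ = BalTensor.tmul k he.Corner (mulToRing k he t • xe) e' := op_mul_smul_eq_tmul k he xe e' t
    _ = 0 := by rw [ht, zero_smul, BalTensor.zero_tmul]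

theorem range_mulToRing : LinearMap.range (mulToRing k he) = idealBeB e := by
  refine le_antisymm ?_ (Submodule.span_le.2 ?_)
  · rintro _ ⟨t, rfl⟩
    induction t using BalTensor.induction_on with
    | tmul x y =>
      rw [mulToRing_tmul, ← (mem_peirceLeft he).1 x.2]
      exact Submodule.smul_mem _ (op y.1) (Submodule.subset_span ⟨x.1, rfl⟩)
    | add x y hx hy => rw [map_add]; exact add_mem hx hy
  · rintro _ ⟨x, rfl⟩
    refine ⟨BalTensor.tmul k he.Corner (x • ⟨e, Submodule.mem_span_singleton_self e⟩)
      ⟨e, Submodule.mem_span_singleton_self e⟩, ?_⟩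
    exact (mul_assoc x e e).trans (congrArg (x * ·) he.eq)

theorem isSIso_mulToRing [IsNoetherianRing Bᵐᵒᵖ] [Module.Finite he.Cornerᵐᵒᵖ ↥(peirceLeft e)]
    {s : EReal} (hs : gkDim k Bᵐᵒᵖ (B ⧸ idealBeB e) ≤ s) : IsSIso k B s (mulToRing k he) := by
  have := BalTensor.finite_right k he.Corner ↥(peirceLeft e) ↥(peirceRight e) B
  refine ⟨(gkDim_le_of_le_ker_orbitMap fun t b hb => ?_).trans hs, ?_⟩
  · exact Subtype.ext (idealBeB_le_ker_orbitMap k he t.2 hb)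
  · have hcoker {I : Submodule Bᵐᵒᵖ B} (hI : I = idealBeB e) : gkDim k Bᵐᵒᵖ (B ⧸ I) ≤ s := hI ▸ hs
    exact hcoker (range_mulToRing k he)

theorem mulToCorner_bijective : Function.Bijective (mulToCorner k he) := by
  let e' : ↥(peirceRight e) := ⟨e, Submodule.mem_span_singleton_self e⟩
  let incl (a : he.Corner) : ↥(peirceLeft e) := ⟨a.1, (mem_peirceLeft he).2 (Corner.right_eq he a)⟩
  let inv (a : he.Corner) : BalTensor k B ↥(peirceRight e) ↥(peirceLeft e) :=
    BalTensor.tmul k B e' (incl a)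
  have inv_add (a a' : he.Corner) : inv (a + a') = inv a + inv a' :=
    BalTensor.tmul_add e' (incl a) (incl a')
  refine Function.bijective_iff_has_inverse.2
    ⟨inv, fun t => ?_, fun a => Subtype.ext (Corner.left_eq he a)⟩
  induction t using BalTensor.induction_on with
  | tmul x y =>
    have hx : op x.1 • e' = x := Subtype.ext ((mem_peirceRight he).1 x.2)
    exact (BalTensor.smul_tmul e' x.1 y).symm.trans (by rw [hx])
  | add t t' ht ht' => rw [map_add, inv_add, ht, ht']

end Multiplication

section Gradings

variable {k : Type u} [Field k]

theorem isInternal_intGrading {X : Type*} [AddCommGroup X] [Module k X] {𝒳 : ℕ → Submodule k X}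
    (h : DirectSum.IsInternal 𝒳) : DirectSum.IsInternal (intGrading 𝒳) := by
  rw [DirectSum.isInternal_submodule_iff_iSupIndep_and_iSup_eq_top] at h ⊢
  obtain ⟨hind, htop⟩ := h
  refine ⟨fun i => ?_, eq_top_iff.2 ?_⟩
  · cases i with
    | ofNat n =>
      refine (hind n).mono_right (iSup₂_le fun j hj => ?_)
      cases j with
      | ofNat m => exact le_iSup₂_of_le m (fun hm => hj (congrArg Int.ofNat hm)) le_rfl
      | negSucc m => exact bot_le
    | negSucc n => exact disjoint_bot_left
  · rw [← htop]
    exact iSup_le fun n => le_iSup (intGrading 𝒳) (Int.ofNat n)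

theorem isInternal_comap {ι X Y : Type*} [DecidableEq ι] [AddCommGroup X] [Module k X]
    [AddCommGroup Y] [Module k Y] {𝒳 : ι → Submodule k X} (h : DirectSum.IsInternal 𝒳)
    {f : Y →ₗ[k] X} {p : X →+ Y} (hp : Function.LeftInverse p f)
    (hdeg : ∀ i, ∀ x ∈ 𝒳 i, f (p x) ∈ 𝒳 i) :
    DirectSum.IsInternal fun i => (𝒳 i).comap f := by
  rw [DirectSum.isInternal_submodule_iff_iSupIndep_and_iSup_eq_top] at h ⊢
  obtain ⟨hind, htop⟩ := h
  refine ⟨fun i => Submodule.disjoint_def.2 fun y hy hy' => hp.injective ?_,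
    Submodule.eq_top_iff'.2 fun y => ?_⟩
  · have hle : ⨆ j, ⨆ (_ : j ≠ i), (𝒳 j).comap f ≤ (⨆ j, ⨆ (_ : j ≠ i), 𝒳 j).comap f :=
      iSup₂_le fun j hj => Submodule.comap_mono (le_iSup₂_of_le j hj le_rfl)
    rw [map_zero]
    exact Submodule.disjoint_def.1 (hind i) _ hy (hle hy')
  · have hmem (x : X) (hx : x ∈ ⨆ i, 𝒳 i) : p x ∈ ⨆ i, (𝒳 i).comap f := by
      induction hx using Submodule.iSup_induction' with
      | mem i x hx => exact Submodule.mem_iSup_of_mem i (hdeg i x hx)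
      | zero => rw [map_zero]; exact zero_mem _
      | add x x' _ _ hx hx' => rw [map_add]; exact add_mem hx hx'
    rw [← hp y]
    exact hmem (f y) (htop ▸ Submodule.mem_top)

variable {B : Type v} [Ring B] [Algebra k B] {ℬ : ℕ → Submodule k B}

theorem IsLocallyFiniteGrading.mul_mem_intGrading (hℬ : IsLocallyFiniteGrading k ℬ) {p q : ℤ}
    {x y : B} (hx : x ∈ intGrading ℬ p) (hy : y ∈ intGrading ℬ q) :
    x * y ∈ intGrading ℬ (p + q) := by
  cases p with
  | negSucc p => rw [(Submodule.mem_bot k).1 hx, zero_mul]; exact zero_mem _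
  | ofNat p =>
    cases q with
    | negSucc q => rw [(Submodule.mem_bot k).1 hy, mul_zero]; exact zero_mem _
    | ofNat q => exact hℬ.mul_mem hx hy

theorem IsLocallyFiniteGrading.isGradedBimodule (hℬ : IsLocallyFiniteGrading k ℬ) :
    IsGradedBimodule ℬ ℬ (intGrading ℬ) where
  isInternal := isInternal_intGrading hℬ.isInternal
  left_smul_mem i _ _ _ ha hx := hℬ.mul_mem_intGrading (p := Int.ofNat i) ha hx
  right_smul_mem i _ _ _ ha hx := hℬ.mul_mem_intGrading (q := Int.ofNat i) hx ha

variable {e : B}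

theorem isLocallyFiniteGrading_cornerGrading (hℬ : IsLocallyFiniteGrading k ℬ)
    (he : IsIdempotentElem e) (h0 : e ∈ ℬ 0) :
    IsLocallyFiniteGrading k (cornerGrading he ℬ) where
  one_mem := h0
  mul_mem _ _ _ _ ha hb := hℬ.mul_mem ha hb
  isInternal := isInternal_comap hℬ.isInternal (p := Corner.proj he) (Corner.proj_coe he)
    fun i x hx => by
      have hdeg := hℬ.mul_mem (hℬ.mul_mem h0 hx) h0
      rwa [zero_add, add_zero] at hdeg
  finite i := by
    have := hℬ.finite i
    exact Module.Finite.of_injective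
      ((Corner.incl he).restrict (p := cornerGrading he ℬ i) (q := ℬ i) fun _ hx => hx)
      fun x y h => Subtype.ext (Subtype.ext (congrArg (fun z : ↥(ℬ i) => z.1) h))

theorem isGradedBimodule_leftGrading (hℬ : IsLocallyFiniteGrading k ℬ)
    (he : IsIdempotentElem e) (h0 : e ∈ ℬ 0) :
    IsGradedBimodule ℬ (cornerGrading he ℬ) (leftGrading ℬ e) where
  isInternal := isInternal_comap (isInternal_intGrading hℬ.isInternal)
    (p := ((LinearMap.toSpanSingleton B B e).codRestrict (peirceLeft e) fun b =>
      Submodule.smul_mem _ b (Submodule.mem_span_singleton_self e)).toAddMonoidHom)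
    (fun x => Subtype.ext ((mem_peirceLeft he).1 x.2))
    fun i x hx => by
      have hdeg := hℬ.mul_mem_intGrading (q := 0) hx h0
      rwa [add_zero] at hdeg
  left_smul_mem i _ _ _ ha hx := hℬ.mul_mem_intGrading (p := Int.ofNat i) ha hx
  right_smul_mem i _ _ _ ha hx := hℬ.mul_mem_intGrading (q := Int.ofNat i) hx ha

theorem isGradedBimodule_rightGrading (hℬ : IsLocallyFiniteGrading k ℬ)
    (he : IsIdempotentElem e) (h0 : e ∈ ℬ 0) :
    IsGradedBimodule (cornerGrading he ℬ) ℬ (rightGrading ℬ e) where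
  isInternal := isInternal_comap (isInternal_intGrading hℬ.isInternal)
    (p := ((orbitMap e).codRestrict (peirceRight e) fun b =>
      Submodule.smul_mem _ (op b) (Submodule.mem_span_singleton_self e)).toAddMonoidHom)
    (fun x => Subtype.ext ((mem_peirceRight he).1 x.2))
    fun i x hx => by
      have hdeg := hℬ.mul_mem_intGrading (p := 0) h0 hx
      rwa [zero_add] at hdeg
  left_smul_mem i _ _ _ ha hx := hℬ.mul_mem_intGrading (p := Int.ofNat i) ha hx
  right_smul_mem i _ _ _ ha hx := hℬ.mul_mem_intGrading (q := Int.ofNat i) hx ha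

theorem intGrading_cornerGrading (he : IsIdempotentElem e) (i : ℤ) :
    intGrading (cornerGrading he ℬ) i = (intGrading ℬ i).comap (Corner.incl he) := by
  cases i with
  | ofNat n => rfl
  | negSucc n => exact (LinearMap.ker_eq_bot.2 Subtype.val_injective).symm

theorem mulToRing_mem (hℬ : IsLocallyFiniteGrading k ℬ) (he : IsIdempotentElem e) (i : ℤ)
    (t : BalTensor k he.Corner ↥(peirceLeft e) ↥(peirceRight e))
    (ht : t ∈ tensorGrading (leftGrading ℬ e) (rightGrading ℬ e) i) :
    mulToRing k he t ∈ intGrading ℬ i := by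
  refine BalTensor.liftRight_mem (fun p q x hx y hy => ?_) i ht
  exact hℬ.mul_mem_intGrading hx hy

theorem mulToCorner_mem (hℬ : IsLocallyFiniteGrading k ℬ) (he : IsIdempotentElem e) (i : ℤ)
    (t : BalTensor k B ↥(peirceRight e) ↥(peirceLeft e))
    (ht : t ∈ tensorGrading (rightGrading ℬ e) (leftGrading ℬ e) i) :
    mulToCorner k he t ∈ intGrading (cornerGrading he ℬ) i := by
  refine BalTensor.liftRight_mem (fun p q x hx y hy => ?_) i ht
  rw [intGrading_cornerGrading]
  exact hℬ.mul_mem_intGrading hx hy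

end Gradings

theorem quasiResolutionData_peirce {k : Type u} [Field k] {B : Type v} [Ring B] [Algebra k B]
    (hl : IsNoetherianRing B) (hr : IsNoetherianRing Bᵐᵒᵖ) {d : ℕ} (hd : 2 ≤ d)
    (hreg : IsAuslanderRegular B) (hCM : IsCohenMacaulay B k d) {e : B} (he : IsIdempotentElem e)
    (hBe : Module.Finite he.Cornerᵐᵒᵖ ↥(peirceLeft e))
    (heB : Module.Finite he.Corner ↥(peirceRight e))
    (hGK : gkDim k Bᵐᵒᵖ (B ⧸ idealBeB e) ≤ (((d : ℝ) - 2 : ℝ) : EReal)) :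
    QuasiResolutionData k B he.Corner ↥(peirceLeft e) ↥(peirceRight e) d where
  two_le := hd
  left_noetherian_base := Corner.isNoetherianRing he
  right_noetherian_base := Corner.isNoetherianRing_op he
  gkDim_base := by
    have hlt : (((d : ℝ) - 2 : ℝ) : EReal) < ((d : ℝ) : EReal) :=
      EReal.coe_lt_coe_iff.2 (sub_lt_self _ two_pos)
    exact hCM.gkDim_corner he
      (ne_zero_of_gkDim_quotient_lt (hGK.trans_lt (hCM.gkDim_eq.symm ▸ hlt)))
  left_noetherian := hl
  right_noetherian := hr
  auslanderRegular := hreg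
  cohenMacaulay := hCM
  finite_left_M := inferInstance
  finite_right_M := hBe
  finite_left_N := heB
  finite_right_N := inferInstance

end QuasiRes

theorem proposition8p3_general {k : Type*} [Field k] {B : Type*} [Ring B] [Algebra k B]
    (hl : IsNoetherianRing B) (hr : IsNoetherianRing Bᵐᵒᵖ) {d : ℕ} (hd : 2 ≤ d)
    (hreg : QuasiRes.IsAuslanderRegular B) (hCM : QuasiRes.IsCohenMacaulay B k d)
    {e : B} (he : IsIdempotentElem e)
    (hBe : Module.Finite he.Cornerᵐᵒᵖ ↥(QuasiRes.peirceLeft e))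
    (heB : Module.Finite he.Corner ↥(QuasiRes.peirceRight e))
    (hGK : QuasiRes.gkDim k Bᵐᵒᵖ (B ⧸ QuasiRes.idealBeB e) ≤ (((d : ℝ) - 2 : ℝ) : EReal)) :
    QuasiRes.IsNQR k B he.Corner ↥(QuasiRes.peirceLeft e) ↥(QuasiRes.peirceRight e) d ∧
    ∀ ℬ : ℕ → Submodule k B, QuasiRes.IsLocallyFiniteGrading k ℬ → e ∈ ℬ 0 →
      QuasiRes.IsGradedNQR ℬ (QuasiRes.cornerGrading he ℬ)
        (QuasiRes.leftGrading ℬ e) (QuasiRes.rightGrading ℬ e) d := by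
  have data := QuasiRes.quasiResolutionData_peirce hl hr hd hreg hCM he hBe heB hGK
  have hB := QuasiRes.isSIso_mulToRing k he hGK
  have hB_smul := QuasiRes.mulToRing_smul k he
  have hA := QuasiRes.isSIso_of_bijective (k := k) (s := (((d : ℝ) - 2 : ℝ) : EReal))
    (QuasiRes.mulToCorner_bijective k he)
  have hA_smul := QuasiRes.mulToCorner_smul k he
  refine ⟨⟨data, .of_isSIso hB hB_smul, .of_isSIso hA hA_smul⟩, fun ℬ hℬ h0 => ?_⟩
  have h𝒜 := QuasiRes.isLocallyFiniteGrading_cornerGrading hℬ he h0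
  exact
    { data with
      grading_base := h𝒜
      grading := hℬ
      graded_M := QuasiRes.isGradedBimodule_leftGrading hℬ he h0
      graded_N := QuasiRes.isGradedBimodule_rightGrading hℬ he h0
      isoB := .of_isSIso hℬ.isGradedBimodule hB hB_smul (QuasiRes.mulToRing_mem hℬ he)
      isoA := .of_isSIso h𝒜.isGradedBimodule hA hA_smul (QuasiRes.mulToCorner_mem hℬ he) }

theorem proposition8p3 {k : Type*} [Field k] {B : Type*} [Ring B] [Algebra k B]
    (ℬ : ℕ → Submodule k B) (hℬ : QuasiRes.IsLocallyFiniteGrading k ℬ)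
    (hl : IsNoetherianRing B) (hr : IsNoetherianRing Bᵐᵒᵖ)
    (d : ℕ) (hd : 2 ≤ d)
    (hreg : QuasiRes.IsAuslanderRegular B) (hCM : QuasiRes.IsCohenMacaulay B k d)
    {e : B} (he : IsIdempotentElem e)
    (hBe : Module.Finite B ↥(QuasiRes.peirceLeft e))
    (hBe' : Module.Finite he.Cornerᵐᵒᵖ ↥(QuasiRes.peirceLeft e))
    (heB : Module.Finite he.Corner ↥(QuasiRes.peirceRight e))
    (heB' : Module.Finite Bᵐᵒᵖ ↥(QuasiRes.peirceRight e))
    (hGK : QuasiRes.gkDim k Bᵐᵒᵖ (B ⧸ QuasiRes.idealBeB e) ≤ (((d : ℝ) - 2 : ℝ) : EReal)) :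
    QuasiRes.IsNQR k B he.Corner ↥(QuasiRes.peirceLeft e) ↥(QuasiRes.peirceRight e) d ∧
    (e ∈ ℬ 0 →
      QuasiRes.IsGradedNQR ℬ (QuasiRes.cornerGrading he ℬ)
        (QuasiRes.leftGrading ℬ e) (QuasiRes.rightGrading ℬ e) d) := by
  obtain ⟨hNQR, hgraded⟩ := proposition8p3_general hl hr hd hreg hCM he hBe' heB hGK
  exact ⟨hNQR, hgraded ℬ hℬ⟩
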